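/- A finite set of points in the plane is called a convex chain if no two of its points lie on a vertical line and, read from left to right, all its consecutive triples turn strictly left, or all of them turn strictly right; two convex chains have opposed concavity if one of them turns left and the other turns right (chains with at most two points count as both). A double chain is a set $D = U \cup L$, where $U$ (the upper chain) and $L$ (the lower chain) are disjoint finite convex chains with opposed concavity such that the line through any two points of $U$ leaves all points of $L$ strictly below it, and the line through any two points of $L$ leaves all points of $U$ strictly above it. A polygonization of a finite point set $S$ is a non-crossing straight-line Hamiltonian cycle on $S$, that is, a Hamiltonian cycle with vertex set $S$, drawn with straight segments as edges, in which two distinct edges meet at most in a common endpoint. There is an absolute constant $C > 0$ such that for all integers $n, m \ge 0$, every double chain $D = U \cup L$ with $|U| = n$ and $|L| = m$ admits at most $C \cdot 5.610718614^{\,n+m}$ polygonizations. -/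

import Mathlib

namespace DoubleChain

/-- The Euclidean plane, with coordinates `(x, y)`. Only the affine structure is used. -/
abbrev Plane := ℝ × ℝ

/-- Twice the signed area of the triangle `p q r`. If `p` is to the left of `q`
(`p.1 < q.1`), it is positive when `r` lies strictly above the line through `p` and `q`, and
negative when `r` lies strictly below that line. -/
def orient (p q r : Plane) : ℝ :=
  (q.1 - p.1) * (r.2 - p.2) - (q.2 - p.2) * (r.1 - p.1)

/-- A chain that is convex from below: no two points on a vertical line, and the
polygonal line through the points from left to right turns strictly left at every point. -/
def IsCup (A : Finset Plane) : Prop :=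
  Set.InjOn Prod.fst (A : Set Plane) ∧
    ∀ p ∈ A, ∀ q ∈ A, ∀ r ∈ A, p.1 < q.1 → q.1 < r.1 → 0 < orient p q r

/-- A chain with the opposite concavity: no two points on a vertical line, and the
polygonal line through the points from left to right turns strictly right at every point. -/
def IsCap (A : Finset Plane) : Prop :=
  Set.InjOn Prod.fst (A : Set Plane) ∧
    ∀ p ∈ A, ∀ q ∈ A, ∀ r ∈ A, p.1 < q.1 → q.1 < r.1 → orient p q r < 0

/-- `U` and `L` are the upper and the lower chain of a double chain. -/
structure IsDoubleChain (U L : Finset Plane) : Prop where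
  disjoint : Disjoint U L
  /-- both are convex chains, with opposed concavity -/
  opposed : (IsCup U ∧ IsCap L) ∨ (IsCap U ∧ IsCup L)
  /-- the line through any two points of `U` leaves all points of `L` below -/
  lower_below : ∀ p ∈ U, ∀ q ∈ U, p.1 < q.1 → ∀ r ∈ L, orient p q r < 0
  /-- the line through any two points of `L` leaves all points of `U` above -/
  upper_above : ∀ p ∈ L, ∀ q ∈ L, p.1 < q.1 → ∀ r ∈ U, 0 < orient p q r

/-- The straight-line drawing of `G` has no crossings: two distinct edges meet at most in a
common endpoint. -/
def NonCrossing {S : Finset Plane} (G : SimpleGraph S) : Prop :=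
  ∀ a b c d : S, G.Adj a b → G.Adj c d → s(a, b) ≠ s(c, d) →
    segment ℝ (a : Plane) b ∩ segment ℝ (c : Plane) d ⊆
      ({(a : Plane), (b : Plane)} : Set Plane) ∩ {(c : Plane), (d : Plane)}

/-- A polygonization of `S`: a non-crossing Hamiltonian cycle on the point set `S`, as a graph
all of whose edges are edges of the cycle. -/
def IsPolygonization {S : Finset Plane} (G : SimpleGraph S) : Prop :=
  NonCrossing G ∧
    ∃ (a : S) (p : G.Walk a a), p.IsHamiltonianCycle ∧ ∀ e ∈ G.edgeSet, e ∈ p.edges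

/-- The number of polygonizations that the point set `S` admits. -/
noncomputable def numPolygonizations (S : Finset Plane) : ℕ :=
  {G : SimpleGraph S | IsPolygonization G}.ncard

end DoubleChain

/-! Within one chain, two edges whose endpoints alternate from left to right cross, so only the
order of the first coordinates matters. The edges of a polygonization inside a chain form disjoint
noncrossing paths covering that chain, isolated points included, provided that the other chain is
nonempty. The two path systems determine the polygonization (`eq_of_edgesWithin_eq`): all degrees
are two, and edges between the chains that reverse the order cross, so the remaining edges are
forced from left to right. It is therefore enough to bound the number of path systems on `k` ordered
points by the `k`-th power of the constant.

The vertex sets of the paths form a noncrossing partition, which is recovered from the least points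
and the sizes of its blocks (`IsRootMap.eqOn`). At its least point a path splits into two arms, one
entirely to the left of the other. Along an arm every vertex is extreme among those still to come,
so the ups and downs encode the arm (`Arm.eq_of_perm`), with `2 ^ (j - 1)` codes for `j ≥ 1`
vertices.

Writing the two arm codes at each least point and a blank elsewhere gives a word whose letter sizes
add up to `k` and which determines the system. With `P = t / (1 - 2t)` for the nonempty arms, a
letter has generating function at most `1 + t(1 + P + P²)`. Hence there are at most `(1/t + 1 + P +
P²) ^ k` systems, and a near-optimal `t` gives the constant, with `C = 1`. -/

namespace DoubleChain

/-! ### Paths as lists: neighbours and runs -/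

section Lists

variable {α β : Type*}

/-- `x` and `y` are neighbours in the list. -/
def Link : List α → α → α → Prop
  | a :: b :: l, x, y => (x = a ∧ y = b) ∨ (x = b ∧ y = a) ∨ Link (b :: l) x y
  | _, _, _ => False

lemma link_cons_cons {a b x y : α} {l : List α} :
    Link (a :: b :: l) x y ↔ (x = a ∧ y = b) ∨ (x = b ∧ y = a) ∨ Link (b :: l) x y := Iff.rfl

lemma not_link_nil {x y : α} : ¬ Link ([] : List α) x y := id

lemma not_link_singleton {a x y : α} : ¬ Link [a] x y := id

lemma Link.cons {a x y : α} : ∀ {l : List α}, Link l x y → Link (a :: l) x y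
  | [], h => h.elim
  | _ :: _, h => Or.inr (Or.inr h)

lemma Link.symm {x y : α} : ∀ {l : List α}, Link l x y → Link l y x
  | [], h => h.elim
  | [_], h => h.elim
  | a :: b :: l, h => by
    rw [link_cons_cons] at h ⊢
    rcases h with h | h | h
    · exact Or.inr (Or.inl h.symm)
    · exact Or.inl h.symm
    · exact Or.inr (Or.inr h.symm)

lemma Link.mem_left {x y : α} : ∀ {l : List α}, Link l x y → x ∈ l
  | [], h => h.elim
  | [_], h => h.elim
  | a :: b :: l, h => by
    rcases h with h | h | h
    · simp [h.1]
    · simp [h.1]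
    · exact List.mem_cons_of_mem _ h.mem_left

lemma Link.mem_right {x y : α} {l : List α} (h : Link l x y) : y ∈ l := h.symm.mem_left

lemma link_append_cons {b x y : α} {l₂ : List α} : ∀ {l₁ : List α},
    Link (l₁ ++ b :: l₂) x y ↔ Link (l₁ ++ [b]) x y ∨ Link (b :: l₂) x y
  | [] => by simp [not_link_singleton]
  | [a] => by simp [link_cons_cons, not_link_singleton, or_assoc]
  | a :: c :: l => by
    have := link_append_cons (b := b) (x := x) (y := y) (l₂ := l₂) (l₁ := c :: l)
    simp only [List.cons_append, link_cons_cons] at this ⊢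
    rw [this]
    tauto

lemma link_reverse {x y : α} : ∀ {l : List α}, Link l.reverse x y ↔ Link l x y
  | [] => Iff.rfl
  | [_] => Iff.rfl
  | a :: b :: l => by
    have := link_reverse (x := x) (y := y) (l := b :: l)
    rw [List.reverse_cons] at this
    rw [List.reverse_cons, List.reverse_cons, List.append_assoc, List.singleton_append,
      link_append_cons, this]
    simp only [link_cons_cons, not_link_singleton]
    tauto

lemma link_map {f : α → β} {x y : β} : ∀ {l : List α},
    Link (l.map f) x y ↔ ∃ p q, Link l p q ∧ f p = x ∧ f q = y
  | [] => by simp [not_link_nil]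
  | [_] => by simp [not_link_singleton]
  | a :: b :: l => by
    have := link_map (f := f) (x := x) (y := y) (l := b :: l)
    simp only [List.map_cons, link_cons_cons] at this ⊢
    rw [this]
    constructor
    · rintro (⟨rfl, rfl⟩ | ⟨rfl, rfl⟩ | ⟨p, q, h, rfl, rfl⟩)
      · exact ⟨a, b, by simp, rfl, rfl⟩
      · exact ⟨b, a, by simp, rfl, rfl⟩
      · exact ⟨p, q, Or.inr (Or.inr h), rfl, rfl⟩
    · rintro ⟨p, q, ⟨rfl, rfl⟩ | ⟨rfl, rfl⟩ | h, rfl, rfl⟩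
      · exact Or.inl ⟨rfl, rfl⟩
      · exact Or.inr (Or.inl ⟨rfl, rfl⟩)
      · exact Or.inr (Or.inr ⟨p, q, h, rfl, rfl⟩)

/-- A predicate that does not change between neighbours is constant on the list. -/
lemma iff_of_link_iff {P : α → Prop} : ∀ {l : List α},
    (∀ x y, Link l x y → (P x ↔ P y)) → ∀ x ∈ l, ∀ y ∈ l, (P x ↔ P y)
  | [], _ => by simp
  | [_], _ => by simp
  | a :: b :: l, h => by
    have ih := iff_of_link_iff (P := P) (l := b :: l) fun x y hxy => h x y hxy.cons
    have hab : P a ↔ P b := h a b (Or.inl ⟨rfl, rfl⟩)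
    have key : ∀ x ∈ a :: b :: l, (P x ↔ P b) := by
      intro x hx
      rcases List.mem_cons.1 hx with rfl | hx
      · exact hab
      · exact ih x hx b (by simp)
    exact fun x hx y hy => (key x hx).trans (key y hy).symm

/-- The maximal runs of elements of a list that satisfy `p`; the first one may be empty. -/
lemma exists_runs (p : α → Prop) [DecidablePred p] : ∀ v : List α,
    ∃ (r : List α) (R : List (List α)), (r :: R).flatten = v.filter (fun x => decide (p x)) ∧
      (∀ x, r.head? = some x ↔ v.head? = some x ∧ p x) ∧
      ∀ x y, (∃ l ∈ r :: R, Link l x y) ↔ Link v x y ∧ p x ∧ p y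
  | [] => ⟨[], [], by simp [not_link_nil]⟩
  | a :: v => by
    obtain ⟨r, R, h₁, h₂, h₃⟩ := exists_runs p v
    by_cases ha : p a
    · refine ⟨a :: r, R, by simpa [ha] using h₁, by simp; grind, fun x y => ?_⟩
      -- Prepending `a` to the first run adds a link exactly when the next element of `v` also
      -- satisfies `p`; this is why the head of that run is tracked.
      have key : Link (a :: r) x y ↔
          Link r x y ∨ ∃ b, v.head? = some b ∧ p b ∧ ((x = a ∧ y = b) ∨ (x = b ∧ y = a)) := by
        cases r with
        | nil => simp at h₂; simp [not_link_nil, not_link_singleton]; grind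
        | cons c r =>
          have := (h₂ c).1 rfl
          rw [link_cons_cons]; simp at h₂; grind
      have key' : Link (a :: v) x y ↔
          Link v x y ∨ ∃ b, v.head? = some b ∧ ((x = a ∧ y = b) ∨ (x = b ∧ y = a)) := by
        cases v with
        | nil => simp [not_link_nil, not_link_singleton]
        | cons c v => rw [link_cons_cons]; simp; tauto
      have h₄ := h₃ x y
      simp only [List.mem_cons, exists_eq_or_imp] at h₄ ⊢
      rw [key, key']
      constructor
      · rintro ((h | ⟨b, hb, hpb, h⟩) | h)
        · exact ⟨Or.inl (h₄.1 (Or.inl h)).1, (h₄.1 (Or.inl h)).2⟩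
        · exact ⟨Or.inr ⟨b, hb, h⟩, by grind⟩
        · exact ⟨Or.inl (h₄.1 (Or.inr h)).1, (h₄.1 (Or.inr h)).2⟩
      · rintro ⟨h | ⟨b, hb, h⟩, hx, hy⟩
        · rcases h₄.2 ⟨h, hx, hy⟩ with h | h <;> simp [h]
        · exact Or.inl (Or.inr ⟨b, hb, by grind, h⟩)
    · refine ⟨[], r :: R, by simpa [ha] using h₁, by simp; grind, fun x y => ?_⟩
      have h₄ := h₃ x y
      rw [List.exists_mem_cons_iff, h₄]
      cases v with
      | nil => simp [not_link_nil, not_link_singleton]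
      | cons c v => rw [link_cons_cons]; simp [not_link_nil]; grind

end Lists

/-! ### Noncrossing paths on a line and their arms -/

section Order

variable {α : Type*} [LinearOrder α]

/-- No two edges `a c` and `b d` with `a < b < c < d`. -/
def Laminar (E : α → α → Prop) : Prop :=
  ∀ a b c d, a < b → b < c → c < d → E a c → E b d → False

/-- `z` lies strictly between `x` and `y`. -/
def Btw (x y z : α) : Prop := (x < z ∧ z < y) ∨ (y < z ∧ z < x)

lemma Laminar.mono {E F : α → α → Prop} (hE : Laminar E) (h : ∀ x y, F x y → E x y) :
    Laminar F := fun a b c d h₁ h₂ h₃ hac hbd => hE a b c d h₁ h₂ h₃ (h _ _ hac) (h _ _ hbd)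

/-- If exactly one of `e`, `f` were between `x` and `y`, the two edges would alternate; the eight
instances cover all orders of the endpoints. -/
lemma Laminar.btw_iff {E : α → α → Prop} (hE : Laminar E) (hs : ∀ x y, E x y → E y x)
    {x y e f : α} (hxy : E x y) (hef : E e f) (h₁ : e ≠ x) (h₂ : e ≠ y) (h₃ : f ≠ x)
    (h₄ : f ≠ y) : Btw x y e ↔ Btw x y f := by
  have hyx := hs _ _ hxy
  have hfe := hs _ _ hef
  have c1 := hE x e y f
  have c2 := hE y e x f
  have c3 := hE x f y e
  have c4 := hE y f x e
  have c5 := hE e x f y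
  have c6 := hE e y f x
  have c7 := hE f x e y
  have c8 := hE f y e x
  unfold Btw
  grind

lemma btw_iff_swap {x y e f : α} (h₁ : e ≠ x) (h₂ : e ≠ y) (h₃ : f ≠ x) (h₄ : f ≠ y)
    (h : Btw x y e ↔ Btw x y f) : Btw e f x ↔ Btw e f y := by
  unfold Btw at *
  grind

/-- Disjoint paths of a laminar graph do not separate each other. -/
lemma Laminar.btw_iff_of_mem {E : α → α → Prop} (hE : Laminar E) (hs : ∀ x y, E x y → E y x)
    {l₁ l₂ : List α} (hl₁ : ∀ x y, Link l₁ x y → E x y) (hl₂ : ∀ x y, Link l₂ x y → E x y)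
    (hd : ∀ x ∈ l₁, ∀ y ∈ l₂, x ≠ y) {x x' y y' : α} (hx : x ∈ l₁) (hx' : x' ∈ l₁)
    (hy : y ∈ l₂) (hy' : y' ∈ l₂) : Btw y y' x ↔ Btw y y' x' := by
  -- Two walks: along `l₂`, no edge `e f` of `l₁` separates `y` from `y'`; hence, along `l₁`, no
  -- edge enters or leaves the interval between `y` and `y'`.
  refine iff_of_link_iff (P := Btw y y') (fun e f hef => ?_) x hx x' hx'
  have he := hef.mem_left
  have hf := hef.mem_right
  refine btw_iff_swap (hd e he y hy).symm (hd f hf y hy).symm (hd e he y' hy').symm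
    (hd f hf y' hy').symm ?_
  refine iff_of_link_iff (P := Btw e f) (fun u v huv => ?_) y hy y' hy'
  have hu := huv.mem_left
  have hv := huv.mem_right
  exact hE.btw_iff hs (hl₁ _ _ hef) (hl₂ _ _ huv) (hd e he u hu).symm (hd f hf u hu).symm
    (hd e he v hv).symm (hd f hf v hv).symm

/-- Every element is the least or the greatest of the elements from it onwards. -/
def Arm : List α → Prop
  | [] => True
  | x :: l => ((∀ y ∈ l, x < y) ∨ (∀ y ∈ l, y < x)) ∧ Arm l

/-- The rest of the path does not cross the edge from `r` to `x`, so it lies entirely between them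
or entirely beyond `x`. As `r` is extreme, `x` is extreme among the points from it onwards. -/
lemma arm_of_laminar : ∀ {l : List α} {r : α}, (r :: l).Nodup → Laminar (Link (r :: l)) →
    ((∀ y ∈ l, r < y) ∨ (∀ y ∈ l, y < r)) → Arm l
  | [], _, _, _, _ => trivial
  | x :: l, r, hn, hE, hr => by
    have hn' : (x :: l).Nodup := (List.nodup_cons.1 hn).2
    have hx : (∀ y ∈ l, x < y) ∨ (∀ y ∈ l, y < x) := by
      have hne : ∀ y ∈ l, y ≠ x ∧ y ≠ r := by
        intro y hy
        simp only [List.nodup_cons, List.mem_cons] at hn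
        constructor <;> rintro rfl <;> tauto
      have hb : ∀ y ∈ l, ∀ z ∈ l, (Btw r x y ↔ Btw r x z) := by
        refine iff_of_link_iff fun e f hef => ?_
        have he := hne e hef.mem_left
        have hf := hne f hef.mem_right
        exact hE.btw_iff (fun _ _ h => h.symm) (Or.inl ⟨rfl, rfl⟩) hef.cons.cons he.2 he.1 hf.2 hf.1
      by_contra! hcon
      obtain ⟨⟨y, hy, hyx⟩, z, hz, hxz⟩ := hcon
      have h1 := hb y hy z hz
      have h2 := hne y hy
      have h3 := hne z hz
      rcases hr with hr | hr
      · have h4 := hr y (by simp [hy])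
        have h5 := hr z (by simp [hz])
        have h6 := hr x (by simp)
        unfold Btw at h1
        grind
      · have h4 := hr y (by simp [hy])
        have h5 := hr z (by simp [hz])
        have h6 := hr x (by simp)
        unfold Btw at h1
        grind
    exact ⟨hx, arm_of_laminar hn' (hE.mono fun _ _ h => h.cons) hx⟩

/-- The pattern of ascents and descents of a list, padded to the length of the list. -/
def pattern : List α → List Bool
  | [] => []
  | [_] => [false]
  | x :: y :: l => decide (x < y) :: pattern (y :: l)

lemma length_pattern : ∀ l : List α, (pattern l).length = l.length
  | [] => rfl
  | [_] => rfl
  | x :: y :: l => by simp [pattern, length_pattern (y :: l)]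

/-- The first entry is the minimum or the maximum of the underlying set, and the first bit says
which; the entries are thus recovered one by one. -/
lemma Arm.eq_of_perm : ∀ {l l' : List α}, Arm l → Arm l' → l.Perm l' →
    pattern l = pattern l' → l = l'
  | [], l', _, _, hp, _ => (List.nil_perm.1 hp).symm
  | [x], l', _, _, hp, _ => (List.singleton_perm.1 hp)
  | x :: y :: l, [], _, _, hp, _ => by simp at hp
  | x :: y :: l, [z], _, _, hp, _ => by simpa using hp.length_eq
  | x :: y :: l, x' :: y' :: l', h, h', hp, hc => by
    simp only [pattern, List.cons.injEq, decide_eq_decide] at hc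
    have hx : x = x' := by
      have m1 : x ∈ x' :: y' :: l' := hp.mem_iff.1 (by simp)
      have m2 : x' ∈ x :: y :: l := hp.mem_iff.2 (by simp)
      have a1 := h.1
      have a2 := h'.1
      have b1 : y ∈ y :: l := by simp
      have b2 : y' ∈ y' :: l' := by simp
      rw [List.mem_cons] at m1 m2
      by_contra hne
      have m1 := m1.resolve_left hne
      have m2 := m2.resolve_left (Ne.symm hne)
      rcases a1 with a1 | a1 <;> rcases a2 with a2 | a2
      · exact lt_asymm (a1 _ m2) (a2 _ m1)
      · exact lt_asymm (hc.1.1 (a1 _ b1)) (a2 _ b2)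
      · exact lt_asymm (hc.1.2 (a2 _ b2)) (a1 _ b1)
      · exact lt_asymm (a1 _ m2) (a2 _ m1)
    subst hx
    rw [Arm.eq_of_perm h.2 h'.2 hp.cons_inv hc.2]

/-- A noncrossing path consists of two arms that start at its least point and are separated
by a point of the line. -/
lemma exists_arms {l : List α} (hn : l.Nodup) (hl : l ≠ []) (hE : Laminar (Link l)) :
    ∃ (b : α) (X Y : List α), (b :: (X ++ Y)).Perm l ∧ (∀ x ∈ X ++ Y, b < x) ∧ Arm X ∧ Arm Y ∧
      (∀ x ∈ X, ∀ y ∈ Y, x < y) ∧ (Y = [] → X = []) ∧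
      ∀ x y, Link l x y ↔ Link (b :: X) x y ∨ Link (b :: Y) x y := by
  classical
  obtain ⟨b, hb, hmin⟩ := Finset.exists_min_image l.toFinset id
    (List.toFinset_nonempty_iff _ |>.2 hl)
  simp only [List.mem_toFinset, id] at hb hmin
  obtain ⟨l₁, Y, rfl⟩ := List.append_of_mem hb
  obtain ⟨X, rfl⟩ : ∃ X : List α, X.reverse = l₁ := ⟨l₁.reverse, by simp⟩
  have hlink : ∀ x y, Link (X.reverse ++ b :: Y) x y ↔ Link (b :: X) x y ∨ Link (b :: Y) x y := by
    intro x y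
    rw [link_append_cons, ← List.reverse_cons, link_reverse]
  have hperm : (b :: (X ++ Y)).Perm (X.reverse ++ b :: Y) :=
    (List.Perm.cons b ((List.reverse_perm X).symm.append_right Y)).trans List.perm_middle.symm
  have hn' := hperm.nodup_iff.2 hn
  rw [List.nodup_cons, List.nodup_append] at hn'
  obtain ⟨hbXY, hnX, hnY, hXY⟩ := hn'
  have hlt : ∀ x ∈ X ++ Y, b < x := by
    intro x hx
    refine lt_of_le_of_ne (hmin x (hperm.mem_iff.1 (by simp [hx]))) ?_
    rintro rfl
    exact hbXY hx
  have hbX : ∀ x ∈ X, b < x := fun x hx => hlt x (by simp [hx])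
  have hbY : ∀ x ∈ Y, b < x := fun x hx => hlt x (by simp [hx])
  have aX : Arm X := arm_of_laminar (r := b) (List.nodup_cons.2 ⟨fun h => (hbX b h).false, hnX⟩)
    (hE.mono fun x y h => (hlink x y).2 (Or.inl h)) (Or.inl hbX)
  have aY : Arm Y := arm_of_laminar (r := b) (List.nodup_cons.2 ⟨fun h => (hbY b h).false, hnY⟩)
    (hE.mono fun x y h => (hlink x y).2 (Or.inr h)) (Or.inl hbY)
  -- Two points of one arm that enclosed a point of the other would also enclose `b`, which is less
  -- than all of them.
  have sepY : ∀ y ∈ Y, ∀ y' ∈ Y, ∀ x ∈ X, ¬ Btw y y' x := by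
    intro y hy y' hy' x hx h
    have := (hE.btw_iff_of_mem (fun _ _ h => h.symm) (l₁ := b :: X) (l₂ := Y)
      (fun x y h => (hlink x y).2 (Or.inl h)) (fun x y h => (hlink x y).2 (Or.inr h.cons))
      (by
        intro u hu v hv
        rcases List.mem_cons.1 hu with rfl | hu
        · exact (hbY v hv).ne
        · exact hXY u hu v hv)
      (List.mem_cons_of_mem b hx) (List.mem_cons_self) hy hy').1 h
    rcases this with h | h
    · exact lt_asymm h.1 (hbY y hy)
    · exact lt_asymm h.1 (hbY y' hy')
  have sepX : ∀ y ∈ X, ∀ y' ∈ X, ∀ x ∈ Y, ¬ Btw y y' x := by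
    intro y hy y' hy' x hx h
    have := (hE.btw_iff_of_mem (fun _ _ h => h.symm) (l₁ := b :: Y) (l₂ := X)
      (fun x y h => (hlink x y).2 (Or.inr h)) (fun x y h => (hlink x y).2 (Or.inl h.cons))
      (by
        intro u hu v hv
        rcases List.mem_cons.1 hu with rfl | hu
        · exact (hbX v hv).ne
        · exact (hXY v hv u hu).symm)
      (List.mem_cons_of_mem b hx) (List.mem_cons_self) hy hy').1 h
    rcases this with h | h
    · exact lt_asymm h.1 (hbX y hy)
    · exact lt_asymm h.1 (hbX y' hy')
  have hord : (∀ x ∈ X, ∀ y ∈ Y, x < y) ∨ (∀ x ∈ X, ∀ y ∈ Y, y < x) := by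
    by_contra! hcon
    obtain ⟨⟨x, hx, y, hy, hyx⟩, x', hx', y', hy', hxy'⟩ := hcon
    have h1 := sepY y hy y' hy' x hx
    have h2 := sepX x hx x' hx' y hy
    have h3 := sepX x hx x' hx' y' hy'
    have h4 := hXY x hx y hy
    have h5 := hXY x' hx' y' hy'
    have h6 := hXY x hx y' hy'
    unfold Btw at h1 h2 h3
    grind
  have swap : (b :: (Y ++ X)).Perm (X.reverse ++ b :: Y) :=
    (List.Perm.cons b List.perm_append_comm).trans hperm
  -- Normal form: a single arm is put second, and of two arms the left one comes first. Otherwise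
  -- the words would overcount paths by reversal.
  by_cases hY : Y = []
  · subst hY
    exact ⟨b, [], X, by simpa using hperm, by simpa using hlt, trivial, aX, by simp, fun _ => rfl,
      fun x y => by rw [hlink, or_comm]⟩
  by_cases hX : X = []
  · subst hX
    exact ⟨b, [], Y, hperm, hlt, aX, aY, by simp, fun _ => rfl, hlink⟩
  rcases hord with h | h
  · exact ⟨b, X, Y, hperm, hlt, aX, aY, h, fun h => (hY h).elim, hlink⟩
  · exact ⟨b, Y, X, swap, fun x hx => hlt x (by simp at hx ⊢; tauto), aY, aX,
      fun x hx y hy => h y hy x hx, fun h => (hX h).elim, fun x y => by rw [hlink, or_comm]⟩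

end Order

end DoubleChain

namespace DoubleChain

/-! ### Noncrossing partitions from least points and block sizes -/

section Roots

variable {α : Type*} [LinearOrder α]

/-- `m` sends each point of `A` to the least point of its block in a noncrossing partition. -/
structure IsRootMap (A : Finset α) (m : α → α) : Prop where
  mem : ∀ i ∈ A, m i ∈ A
  le : ∀ i ∈ A, m i ≤ i
  idem : ∀ i ∈ A, m (m i) = m i
  noncrossing : ∀ i ∈ A, ∀ j ∈ A, ∀ k ∈ A, ∀ l ∈ A, i < j → j < k → k < l →
    m i = m k → m j = m l → m i = m j

/-- Let `i` be the first disagreement and suppose `m i < m' i`. Under `m`, no point after `i` is in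
the block of `m' i`, since it would cross the pair `m i`, `i`. That block thus lies before `i`,
where the maps agree, while under `m'` it also contains `i`: the sizes differ. -/
lemma IsRootMap.not_lt {A : Finset α} {m m' : α → α} (hm : IsRootMap A m) (hm' : IsRootMap A m')
    (hroot : ∀ b ∈ A, m b = b ↔ m' b = b)
    (hcard : ∀ b ∈ A, m b = b → (A.filter (m · = b)).card = (A.filter (m' · = b)).card)
    {i : α} (hi : i ∈ A) (hmin : ∀ j ∈ A, j < i → m j = m' j) : ¬ m i < m' i := by
  intro hlt
  have ha' : m' i ∈ A := hm'.mem i hi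
  have hroot' : m (m' i) = m' i := (hroot _ ha').2 (hm'.idem i hi)
  have hle : m' i < i := by
    refine lt_of_le_of_ne (hm'.le i hi) fun h => ?_
    rw [h] at hroot' hlt
    exact hlt.ne hroot'
  have hsub : A.filter (m · = m' i) ⊂ A.filter (m' · = m' i) := by
    rw [Finset.ssubset_iff_of_subset]
    · exact ⟨i, by simp [hi], by simp [hlt.ne]⟩
    · intro j hj
      rw [Finset.mem_filter] at hj ⊢
      refine ⟨hj.1, ?_⟩
      have hji : j < i := by
        rcases lt_trichotomy j i with h | h | h
        · exact h
        · rw [h] at hj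
          exact (hlt.ne hj.2).elim
        · have := hm.noncrossing (m i) (hm.mem i hi) (m' i) ha' i hi j hj.1 hlt hle h
            (hm.idem i hi) (by rw [hroot', hj.2])
          rw [hm.idem i hi, hroot'] at this
          exact (hlt.ne this).elim
      rw [← hmin j hj.1 hji, hj.2]
  exact (Finset.card_lt_card hsub).ne (hcard _ ha' hroot')

/-- A noncrossing partition is determined by the least points and the sizes of its blocks. -/
lemma IsRootMap.eqOn {A : Finset α} {m m' : α → α} (hm : IsRootMap A m) (hm' : IsRootMap A m')
    (hroot : ∀ b ∈ A, m b = b ↔ m' b = b)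
    (hcard : ∀ b ∈ A, m b = b → (A.filter (m · = b)).card = (A.filter (m' · = b)).card) :
    ∀ i ∈ A, m i = m' i := by
  by_contra! hcon
  have hne : (A.filter fun i => m i ≠ m' i).Nonempty := by
    obtain ⟨i, hi, h⟩ := hcon
    exact ⟨i, by simp [hi, h]⟩
  obtain ⟨i, hi, hmin⟩ := Finset.exists_min_image _ id hne
  rw [Finset.mem_filter] at hi
  have hmin' : ∀ j ∈ A, j < i → m j = m' j := by
    intro j hj hji
    by_contra h
    exact (hmin j (by simp [hj, h])).not_gt hji
  rcases lt_or_gt_of_ne hi.2 with h | h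
  · exact hm.not_lt hm' hroot hcard hi.1 hmin' h
  · exact hm'.not_lt hm (fun b hb => (hroot b hb).symm)
      (fun b hb hb' => (hcard b hb ((hroot b hb).2 hb')).symm) hi.1
      (fun j hj hji => (hmin' j hj hji).symm) h

end Roots

/-! ### Path systems and their encoding by letters -/

section Forests

variable {α : Type*} [LinearOrder α]

/-- `E` is the union of paths that partition `A` without crossings: the path with least point
`b` consists of the two arms `X b` and `Y b`. -/
structure IsArmForest (A : Finset α) (E : α → α → Prop) (m : α → α) (X Y : α → List α) :
    Prop where
  root : IsRootMap A m
  nodup : ∀ b ∈ A, m b = b → (b :: (X b ++ Y b)).Nodup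
  mem_iff : ∀ b ∈ A, m b = b → ∀ i, i ∈ b :: (X b ++ Y b) ↔ i ∈ A ∧ m i = b
  arm_left : ∀ b ∈ A, m b = b → Arm (X b)
  arm_right : ∀ b ∈ A, m b = b → Arm (Y b)
  lt : ∀ b ∈ A, m b = b → ∀ x ∈ X b, ∀ y ∈ Y b, x < y
  nil : ∀ b ∈ A, m b = b → Y b = [] → X b = []
  edge : ∀ x y, E x y ↔ ∃ b ∈ A, m b = b ∧ (Link (b :: X b) x y ∨ Link (b :: Y b) x y)

/-- Initial segments of the same length of the same set have the same elements. -/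
lemma initial_perm {X Y X' Y' : List α} (hn : (X ++ Y).Nodup) (hn' : (X' ++ Y').Nodup)
    (hmem : ∀ i, i ∈ X ++ Y ↔ i ∈ X' ++ Y') (hlen : X.length = X'.length)
    (hlt : ∀ x ∈ X, ∀ y ∈ Y, x < y) (hlt' : ∀ x ∈ X', ∀ y ∈ Y', x < y) : X.Perm X' := by
  have nX := (List.nodup_append.1 hn).1
  have nX' := (List.nodup_append.1 hn').1
  have hsub : X ⊆ X' ∨ X' ⊆ X := by
    by_contra! hcon
    simp only [List.subset_def, not_forall] at hcon
    obtain ⟨⟨x, hx, hxX⟩, x', hx', hxX'⟩ := hcon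
    have h1 := (List.mem_append.1 ((hmem x).1 (by simp [hx]))).resolve_left hxX
    have h2 := (List.mem_append.1 ((hmem x').2 (by simp [hx']))).resolve_left hxX'
    exact lt_asymm (hlt x hx x' h2) (hlt' x' hx' x h1)
  rcases hsub with h | h
  · exact (List.subperm_of_subset nX h).perm_of_length_le hlen.ge
  · exact ((List.subperm_of_subset nX' h).perm_of_length_le hlen.le).symm

/-- A union of disjoint paths on `A` without crossings. -/
def IsPathForest (A : Finset α) (E : α → α → Prop) : Prop :=
  ∃ m X Y, IsArmForest A E m X Y

/-- The root of a point is the least point of its list, where the list splits into arms. Empty lists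
are allowed because runs may be empty. -/
lemma isPathForest_of_lists {A : Finset α} {E : α → α → Prop} {R : List (List α)}
    (hn : R.flatten.Nodup) (hA : ∀ i, i ∈ R.flatten ↔ i ∈ A)
    (hE : ∀ x y, E x y ↔ ∃ l ∈ R, Link l x y) (hlam : Laminar E) : IsPathForest A E := by
  classical
  have hEs : ∀ x y, E x y → E y x := by
    intro x y h
    obtain ⟨l, hl, h⟩ := (hE x y).1 h
    exact (hE y x).2 ⟨l, hl, h.symm⟩
  have hsub : ∀ l ∈ R, ∀ x y, Link l x y → E x y := fun l hl x y h => (hE x y).2 ⟨l, hl, h⟩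
  rw [List.nodup_flatten] at hn
  have huniq : ∀ l ∈ R, ∀ l' ∈ R, ∀ x, x ∈ l → x ∈ l' → l = l' := by
    intro l hl l' hl' x hx hx'
    by_contra hne
    have : Std.Symm (List.Disjoint (α := α)) := ⟨fun _ _ h => h.symm⟩
    exact hn.2.forall hl hl' hne hx hx'
  rcases isEmpty_or_nonempty α with hα | hα
  · exact ⟨id, fun _ => [], fun _ => [], ⟨isEmptyElim, isEmptyElim, isEmptyElim, isEmptyElim⟩,
      isEmptyElim, isEmptyElim, isEmptyElim, isEmptyElim, isEmptyElim, isEmptyElim, isEmptyElim⟩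
  have harms : ∀ l : List α, ∃ (b : α) (X Y : List α), l ∈ R → l ≠ [] →
      (b :: (X ++ Y)).Perm l ∧ (∀ x ∈ X ++ Y, b < x) ∧ Arm X ∧ Arm Y ∧
      (∀ x ∈ X, ∀ y ∈ Y, x < y) ∧ (Y = [] → X = []) ∧
      ∀ x y, Link l x y ↔ Link (b :: X) x y ∨ Link (b :: Y) x y := by
    intro l
    by_cases h : l ∈ R ∧ l ≠ []
    · obtain ⟨b, X, Y, h'⟩ := exists_arms (hn.1 l h.1) h.2 (hlam.mono (hsub l h.1))
      exact ⟨b, X, Y, fun _ _ => h'⟩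
    · exact ⟨hα.some, [], [], fun h₁ h₂ => (h ⟨h₁, h₂⟩).elim⟩
  choose b X Y hperm hlt hX hY hXY hnil hlink using harms
  have hL : ∀ i, ∃ l, i ∈ A → l ∈ R ∧ i ∈ l := by
    intro i
    by_cases hi : i ∈ A
    · obtain ⟨l, hl⟩ := List.mem_flatten.1 ((hA i).2 hi)
      exact ⟨l, fun _ => hl⟩
    · exact ⟨[], fun h => (hi h).elim⟩
  choose L hLR hiL using hL
  have hLne : ∀ i ∈ A, L i ≠ [] := fun i hi => List.ne_nil_of_mem (hiL i hi)
  have hLA : ∀ i ∈ A, ∀ j ∈ L i, j ∈ A := fun i hi j hj =>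
    (hA j).1 (List.mem_flatten.2 ⟨L i, hLR i hi, hj⟩)
  have hLeq : ∀ l ∈ R, ∀ i ∈ l, L i = l := by
    intro l hl i hi
    have hiA : i ∈ A := (hA i).1 (List.mem_flatten.2 ⟨l, hl, hi⟩)
    exact huniq _ (hLR i hiA) l hl i (hiL i hiA) hi
  have hbl : ∀ l ∈ R, l ≠ [] → b l ∈ l := fun l hl hne =>
    (hperm l hl hne).mem_iff.1 List.mem_cons_self
  have hbmin : ∀ l ∈ R, ∀ i ∈ l, b l ≤ i := by
    intro l hl i hi
    have := (hperm l hl (List.ne_nil_of_mem hi)).mem_iff.2 hi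
    rcases List.mem_cons.1 this with h | h
    · exact h.ge
    · exact (hlt l hl (List.ne_nil_of_mem hi) i h).le
  have hLb : ∀ i ∈ A, L (b (L i)) = L i := fun i hi =>
    hLeq _ (hLR i hi) _ (hbl _ (hLR i hi) (hLne i hi))
  refine ⟨fun i => b (L i), fun i => X (L i), fun i => Y (L i), ⟨fun i hi => ?_, fun i hi => ?_,
    fun i hi => ?_, fun i hi j hj k hk l hl hij hjk hkl hik hjl => ?_⟩, fun c hc hcb => ?_,
    fun c hc hcb i => ?_, fun c hc hcb => ?_, fun c hc hcb => ?_, fun c hc hcb => ?_,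
    fun c hc hcb => ?_, fun x y => ?_⟩
  · exact hLA i hi _ (hbl _ (hLR i hi) (hLne i hi))
  · exact hbmin _ (hLR i hi) i (hiL i hi)
  · simp only [hLb i hi]
  · have e1 : L k = L i := by rw [← hLb k hk, ← hik, hLb i hi]
    have e2 : L l = L j := by rw [← hLb l hl, ← hjl, hLb j hj]
    by_contra hne
    have hd : ∀ x ∈ L j, ∀ y ∈ L i, x ≠ y := by
      rintro x hx _ hy rfl
      exact hne (by simp only [huniq _ (hLR i hi) _ (hLR j hj) x hy hx])
    -- The path through `j` and `l` is disjoint from the one through `i` and `k`, yet `j` lies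
    -- between `i` and `k` and `l` does not.
    have hb := hlam.btw_iff_of_mem hEs (hsub _ (hLR j hj)) (hsub _ (hLR i hi)) hd (hiL j hj)
      (e2 ▸ hiL l hl) (hiL i hi) (e1 ▸ hiL k hk)
    rcases hb.1 (Or.inl ⟨hij, hjk⟩) with h | h
    · exact lt_asymm h.2 hkl
    · exact lt_asymm h.2 (hij.trans (hjk.trans hkl))
  · have := (hperm _ (hLR c hc) (hLne c hc)).nodup_iff.2 (hn.1 _ (hLR c hc))
    rwa [hcb] at this
  · have := (hperm _ (hLR c hc) (hLne c hc)).mem_iff (a := i)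
    rw [hcb] at this
    rw [this]
    constructor
    · intro hi
      exact ⟨hLA c hc i hi, by rw [hLeq _ (hLR c hc) i hi, hcb]⟩
    · rintro ⟨hi, hic⟩
      rw [← hic, hLb i hi]
      exact hiL i hi
  · exact hX _ (hLR c hc) (hLne c hc)
  · exact hY _ (hLR c hc) (hLne c hc)
  · exact hXY _ (hLR c hc) (hLne c hc)
  · exact hnil _ (hLR c hc) (hLne c hc)
  · rw [hE]
    constructor
    · rintro ⟨l, hl, h⟩
      have hne : l ≠ [] := List.ne_nil_of_mem h.mem_left
      have hb := hbl l hl hne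
      have hLl := hLeq l hl _ hb
      refine ⟨b l, (hA _).1 (List.mem_flatten.2 ⟨l, hl, hb⟩), by simp only [hLl], ?_⟩
      simp only [hLl]
      exact (hlink l hl hne x y).1 h
    · rintro ⟨c, hc, hcb, h⟩
      refine ⟨L c, hLR c hc, (hlink _ (hLR c hc) (hLne c hc) x y).2 ?_⟩
      rwa [hcb]

/-- The letter of a vertex: the codes of the two arms at the least point of a path, and `none`
at all other points. -/
def letter (m : α → α) (X Y : α → List α) (b : α) : Option (List Bool × List Bool) :=
  if m b = b then some (pattern (X b), pattern (Y b)) else none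

/-- The number of points of the path that a letter stands for. -/
def letterSize : Option (List Bool × List Bool) → ℕ
  | none => 0
  | some (u, v) => u.length + v.length + 1

lemma IsArmForest.card_block {A : Finset α} {E : α → α → Prop} {m : α → α} {X Y : α → List α}
    (h : IsArmForest A E m X Y) {b : α} (hb : b ∈ A) (hmb : m b = b) :
    (A.filter (m · = b)).card = letterSize (letter m X Y b) := by
  have : A.filter (m · = b) = (b :: (X b ++ Y b)).toFinset := by
    ext i
    rw [List.mem_toFinset, h.mem_iff b hb hmb, Finset.mem_filter]
  rw [this, List.toFinset_card_of_nodup (h.nodup b hb hmb), letter, if_pos hmb]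
  simp [letterSize, length_pattern]

/-- The letter of a root has the size of its block, and a blank has size zero, so each point is
counted once. -/
lemma IsArmForest.sum_letterSize {A : Finset α} {E : α → α → Prop} {m : α → α}
    {X Y : α → List α} (h : IsArmForest A E m X Y) :
    ∑ i ∈ A, letterSize (letter m X Y i) = A.card := by
  rw [Finset.card_eq_sum_card_fiberwise (f := m) (t := A) fun i hi => h.root.mem i hi]
  refine Finset.sum_congr rfl fun b hb => ?_
  by_cases hmb : m b = b
  · rw [h.card_block hb hmb]
  · rw [letter, if_neg hmb, letterSize, eq_comm, Finset.card_eq_zero, Finset.filter_eq_empty_iff]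
    rintro i hi rfl
    exact hmb (h.root.idem i hi)

/-- The letters determine the forest. -/
lemma IsArmForest.edge_eq {A : Finset α} {E E' : α → α → Prop} {m m' : α → α}
    {X Y X' Y' : α → List α} (h : IsArmForest A E m X Y) (h' : IsArmForest A E' m' X' Y')
    (hc : ∀ b ∈ A, letter m X Y b = letter m' X' Y' b) : E = E' := by
  have hroot : ∀ b ∈ A, m b = b ↔ m' b = b := by
    intro b hb
    have := hc b hb
    unfold letter at this
    split_ifs at this <;> simp_all
  -- Roots and sizes fix the blocks; the length of the first code then fixes which points form the
  -- left arm, and the codes fix the order in each arm.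
  have hm := h.root.eqOn h'.root hroot fun b hb hmb => by
    rw [h.card_block hb hmb, h'.card_block hb ((hroot b hb).1 hmb), hc b hb]
  have harms : ∀ b ∈ A, m b = b → X b = X' b ∧ Y b = Y' b := by
    intro b hb hmb
    have hmb' := (hroot b hb).1 hmb
    have hcb := hc b hb
    rw [letter, letter, if_pos hmb, if_pos hmb', Option.some_inj, Prod.mk.injEq] at hcb
    have hlen : (X b).length = (X' b).length := by
      rw [← length_pattern, hcb.1, length_pattern]
    have hmem : ∀ i, i ∈ X b ++ Y b ↔ i ∈ X' b ++ Y' b := by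
      intro i
      have h1 := h.mem_iff b hb hmb i
      have h2 := h'.mem_iff b hb hmb' i
      have n1 := (List.nodup_cons.1 (h.nodup b hb hmb)).1
      have n2 := (List.nodup_cons.1 (h'.nodup b hb hmb')).1
      rw [List.mem_cons] at h1 h2
      have : i ∈ A → m i = m' i := hm i
      constructor
      · intro hi
        have h3 := h1.1 (Or.inr hi)
        refine (h2.2 ⟨h3.1, by rw [← this h3.1, h3.2]⟩).resolve_left ?_
        rintro rfl
        exact n1 hi
      · intro hi
        have h3 := h2.1 (Or.inr hi)
        refine (h1.2 ⟨h3.1, by rw [this h3.1, h3.2]⟩).resolve_left ?_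
        rintro rfl
        exact n2 hi
    have hn := (List.nodup_cons.1 (h.nodup b hb hmb)).2
    have hn' := (List.nodup_cons.1 (h'.nodup b hb hmb')).2
    have hperm : (X b ++ Y b).Perm (X' b ++ Y' b) := (List.perm_ext_iff_of_nodup hn hn').2 hmem
    have hXX : (X b).Perm (X' b) := initial_perm hn hn' hmem hlen (h.lt b hb hmb) (h'.lt b hb hmb')
    have hYY : (Y b).Perm (Y' b) :=
      (List.perm_append_left_iff (X b)).1 (hperm.trans (hXX.symm.append_right _))
    exact ⟨(h.arm_left b hb hmb).eq_of_perm (h'.arm_left b hb hmb') hXX hcb.1,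
      (h.arm_right b hb hmb).eq_of_perm (h'.arm_right b hb hmb') hYY hcb.2⟩
  funext x y
  rw [eq_iff_iff, h.edge, h'.edge]
  refine exists_congr fun b => and_congr_right fun hb => ?_
  rw [← hroot b hb]
  refine and_congr_right fun hmb => ?_
  rw [(harms b hb hmb).1, (harms b hb hmb).2]

end Forests

end DoubleChain

namespace DoubleChain

/-! ### Generating function bound for the words -/

section Counting

/-- The nonempty codes of length at most `N`. -/
def armCodes : ℕ → Finset (List Bool)
  | 0 => ∅
  | N + 1 => {[false]} ∪ ((armCodes N).image (List.cons true) ∪ (armCodes N).image (List.cons false))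

lemma pattern_mem_armCodes {α : Type*} [LinearOrder α] : ∀ {l : List α} {N : ℕ}, l ≠ [] →
    l.length ≤ N → pattern l ∈ armCodes N
  | [], _, h, _ => (h rfl).elim
  | _ :: _, 0, _, h => by simp at h
  | [x], N + 1, _, _ => by simp [pattern, armCodes]
  | x :: y :: l, N + 1, _, h => by
    have ih := pattern_mem_armCodes (l := y :: l) (N := N) (by simp) (by simpa using h)
    simp only [pattern, armCodes, Finset.mem_union, Finset.mem_image]
    by_cases hxy : x < y
    · exact Or.inr (Or.inl ⟨_, ih, by simp [hxy]⟩)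
    · exact Or.inr (Or.inr ⟨_, ih, by simp [hxy]⟩)

lemma sum_union_le {ι : Type*} [DecidableEq ι] {s t : Finset ι} {f : ι → ℝ} (hf : ∀ i, 0 ≤ f i) :
    ∑ i ∈ s ∪ t, f i ≤ ∑ i ∈ s, f i + ∑ i ∈ t, f i := by
  rw [← Finset.sum_union_inter]
  exact le_add_of_nonneg_right (Finset.sum_nonneg fun i _ => hf i)

/-- `P` is the fixed point of the recursion for codes: `t` for the padding bit alone and `t * P` for
each choice of a first step. The bound is uniform in the truncation, so finite sums suffice. -/
lemma sum_armCodes_le {t P : ℝ} (ht : 0 ≤ t) (hP0 : 0 ≤ P) (hP : t + 2 * t * P = P) :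
    ∀ N, ∑ w ∈ armCodes N, t ^ w.length ≤ P
  | 0 => by simpa [armCodes] using hP0
  | N + 1 => by
    have ih := sum_armCodes_le ht hP0 hP N
    have hpos : ∀ w : List Bool, 0 ≤ t ^ w.length := fun w => pow_nonneg ht _
    have him : ∀ c : Bool, ∑ w ∈ (armCodes N).image (List.cons c), t ^ w.length ≤ t * P := by
      intro c
      rw [Finset.sum_image fun _ _ _ _ h => (List.cons_inj_right c).1 h]
      simp only [List.length_cons, pow_succ']
      rw [← Finset.mul_sum]
      exact mul_le_mul_of_nonneg_left ih ht
    calc ∑ w ∈ armCodes (N + 1), t ^ w.length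
        ≤ t + (t * P + t * P) := by
          refine (sum_union_le hpos).trans (add_le_add (by simp) ?_)
          exact (sum_union_le hpos).trans (add_le_add (him _) (him _))
      _ = P := by linarith

/-- The letters of size at most `N + 1` with a nonempty second arm if there is a first one. -/
def letters (N : ℕ) : Finset (Option (List Bool × List Bool)) :=
  {none} ∪ ({some ([], [])} ∪ (({[]} ∪ armCodes N) ×ˢ armCodes N).image some)

/-- The blank contributes `1`; a root contributes `t` for itself, times `1`, `P` or `P ^ 2` for no
arm, one arm or two. -/
lemma sum_letters_le {t P : ℝ} (ht : 0 ≤ t) (hP0 : 0 ≤ P) (hP : t + 2 * t * P = P) (N : ℕ) :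
    ∑ c ∈ letters N, t ^ letterSize c ≤ 1 + t * (1 + P + P ^ 2) := by
  have hpos : ∀ c, 0 ≤ t ^ letterSize c := fun c => pow_nonneg ht _
  have h := sum_armCodes_le ht hP0 hP N
  have hnn : 0 ≤ ∑ w ∈ armCodes N, t ^ w.length := Finset.sum_nonneg fun w _ => pow_nonneg ht _
  have h' : ∑ w ∈ {[]} ∪ armCodes N, t ^ w.length ≤ 1 + P :=
    (sum_union_le fun w => pow_nonneg ht _).trans (add_le_add (by simp) h)
  have h2 : ∑ c ∈ (({[]} ∪ armCodes N) ×ˢ armCodes N).image some, t ^ letterSize c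
      ≤ t * ((1 + P) * P) := by
    rw [Finset.sum_image fun _ _ _ _ h => Option.some_inj.1 h, Finset.sum_product]
    simp only [letterSize, pow_add, pow_one, mul_assoc]
    simp only [← Finset.mul_sum, ← Finset.sum_mul, ← mul_assoc]
    rw [mul_assoc t, mul_comm _ t]
    gcongr
  calc ∑ c ∈ letters N, t ^ letterSize c ≤ 1 + (t + t * ((1 + P) * P)) := by
        refine (sum_union_le hpos).trans (add_le_add (by simp [letterSize]) ?_)
        exact (sum_union_le hpos).trans (add_le_add (by simp [letterSize]) h2)
    _ = _ := by ring

variable {α : Type*} [LinearOrder α]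

/-- The words that can encode a forest on `A`. -/
noncomputable def codeWords (A : Finset α) : Finset (A → Option (List Bool × List Bool)) :=
  (Fintype.piFinset fun _ : A => letters A.card).filter
    fun c => ∑ i, letterSize (c i) = A.card

/-- One arm decomposition is chosen for each forest; its uniqueness is not needed, since equal
letters give equal edges by `IsArmForest.edge_eq`. -/
lemma exists_code (A : Finset α) : ∃ code : (α → α → Prop) → A → Option (List Bool × List Bool),
    (∀ E, IsPathForest A E → code E ∈ codeWords A) ∧
    ∀ E E', IsPathForest A E → IsPathForest A E' → code E = code E' → E = E' := by
  have : ∀ E : α → α → Prop, ∃ c : A → Option (List Bool × List Bool), IsPathForest A E →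
      ∃ m X Y, IsArmForest A E m X Y ∧ ∀ i : A, c i = letter m X Y i := by
    intro E
    by_cases hE : IsPathForest A E
    · obtain ⟨m, X, Y, h⟩ := hE
      exact ⟨fun i => letter m X Y i, fun _ => ⟨m, X, Y, h, fun _ => rfl⟩⟩
    · exact ⟨fun _ => none, fun h => (hE h).elim⟩
  choose code hcode using this
  refine ⟨code, fun E hE => ?_, fun E E' hE hE' hEE => ?_⟩
  · obtain ⟨m, X, Y, h, hc⟩ := hcode E hE
    rw [codeWords, Finset.mem_filter, Fintype.mem_piFinset]
    constructor
    · rintro ⟨b, hb⟩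
      rw [hc]
      simp only [letter, letters, Finset.mem_union, Finset.mem_singleton, Finset.mem_image,
        Finset.mem_product]
      split_ifs with hmb
      · right
        have hlen : (X b).length + (Y b).length + 1 ≤ A.card := by
          have := h.card_block hb hmb
          rw [letter, if_pos hmb] at this
          simp only [letterSize, length_pattern] at this
          rw [← this]
          exact Finset.card_filter_le _ _
        by_cases hY : Y b = []
        · left
          rw [hY, h.nil b hb hmb hY]
          rfl
        · refine Or.inr ⟨_, ⟨?_, pattern_mem_armCodes hY (by omega)⟩, rfl⟩
          by_cases hX : X b = []
          · rw [hX]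
            exact Or.inl rfl
          · exact Or.inr (pattern_mem_armCodes hX (by omega))
      · exact Or.inl rfl
    · simp only [hc]
      rw [← h.sum_letterSize, ← Finset.sum_coe_sort A]
  · obtain ⟨m, X, Y, h, hc⟩ := hcode E hE
    obtain ⟨m', X', Y', h', hc'⟩ := hcode E' hE'
    refine h.edge_eq h' fun b hb => ?_
    rw [← hc ⟨b, hb⟩, ← hc' ⟨b, hb⟩, hEE]

/-- Every code word has weight `t ^ A.card`. Dropping the condition on the total size turns the
weighted sum into a product over the points. -/
lemma card_codeWords_mul_pow_le {t P : ℝ} (ht : 0 ≤ t) (hP0 : 0 ≤ P) (hP : t + 2 * t * P = P)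
    (A : Finset α) :
    ((codeWords A).card : ℝ) * t ^ A.card ≤ (1 + t * (1 + P + P ^ 2)) ^ A.card := by
  calc ((codeWords A).card : ℝ) * t ^ A.card
      = ∑ c ∈ codeWords A, ∏ i, t ^ letterSize (c i) := by
        rw [← nsmul_eq_mul, ← Finset.sum_const]
        refine Finset.sum_congr rfl fun c hc => ?_
        rw [Finset.prod_pow_eq_pow_sum, (Finset.mem_filter.1 hc).2]
    _ ≤ ∑ c ∈ Fintype.piFinset fun _ : A => letters A.card, ∏ i, t ^ letterSize (c i) :=
        Finset.sum_le_sum_of_subset_of_nonneg (Finset.filter_subset _ _) fun _ _ _ =>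
          Finset.prod_nonneg fun _ _ => pow_nonneg ht _
    _ = ∏ _i : A, ∑ c ∈ letters A.card, t ^ letterSize c :=
        (Finset.prod_univ_sum (fun _ : A => letters A.card) fun _ c => t ^ letterSize c).symm
    _ = (∑ c ∈ letters A.card, t ^ letterSize c) ^ A.card := by simp
    _ ≤ _ := by
        refine pow_le_pow_left₀ (Finset.sum_nonneg fun _ _ => pow_nonneg ht _) ?_ _
        exact sum_letters_le ht hP0 hP _

lemma card_codeWords_le (A : Finset α) : ((codeWords A).card : ℝ) ≤ 5.610718614 ^ A.card := by
  -- `t` approximates the minimizer of `1/t + 1 + P + P²`, where `P = t / (1 - 2t)`.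
  have h := card_codeWords_mul_pow_le (t := 14199 / 50000) (P := 14199 / 21602) (by norm_num)
    (by norm_num) (by norm_num) A
  rw [← le_div_iff₀ (by positivity), ← div_pow] at h
  exact h.trans (pow_le_pow_left₀ (by norm_num) (by norm_num) _)

end Counting

end DoubleChain

namespace DoubleChain

/-! ### Crossing segments -/

section Geometry

lemma orient_rotate (p q r : Plane) : orient q r p = orient p q r := by
  unfold orient; ring

lemma orient_swap (p q r : Plane) : orient q p r = -orient p q r := by
  unfold orient; ring

/-- The diagonals of a convex quadrilateral meet. -/
lemma segment_inter_nonempty {p q r s : Plane} (h₁ : 0 < orient p q r) (h₂ : 0 < orient q r s)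
    (h₃ : 0 < orient p r s) (h₄ : 0 < orient p q s) :
    (segment ℝ p r ∩ segment ℝ q s).Nonempty := by
  -- Both sides are twice the area of the quadrilateral, cut along either diagonal; the ratios of
  -- these areas are the weights of the intersection point.
  have hsum : orient p q s + orient q r s = orient p q r + orient p r s := by
    unfold orient; ring
  have hpos : 0 < orient p q r + orient p r s := add_pos h₁ h₃
  set w := orient p q r + orient p r s with hw
  refine ⟨(orient q r s / w) • p + (orient p q s / w) • r,
    ⟨_, _, by positivity, by positivity, ?_, rfl⟩,
    ⟨orient p r s / w, orient p q r / w, by positivity, by positivity, ?_, ?_⟩⟩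
  · rw [← add_div, add_comm, hsum, div_self hpos.ne']
  · rw [← add_div, add_comm, ← hw, div_self hpos.ne']
  · ext
    · simp only [Prod.fst_add, Prod.smul_fst, smul_eq_mul]
      field_simp
      unfold orient; ring
    · simp only [Prod.snd_add, Prod.smul_snd, smul_eq_mul]
      field_simp
      unfold orient; ring

/-- Two edges whose endpoints alternate along `T` meet. -/
def Alternating (T : Finset Plane) : Prop :=
  ∀ a ∈ T, ∀ b ∈ T, ∀ c ∈ T, ∀ d ∈ T, a.1 < b.1 → b.1 < c.1 → c.1 < d.1 →
    (segment ℝ a c ∩ segment ℝ b d).Nonempty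

lemma IsCup.alternating {T : Finset Plane} (h : IsCup T) : Alternating T := by
  intro a ha b hb c hc d hd hab hbc hcd
  exact segment_inter_nonempty (h.2 a ha b hb c hc hab hbc) (h.2 b hb c hc d hd hbc hcd)
    (h.2 a ha c hc d hd (hab.trans hbc) hcd) (h.2 a ha b hb d hd hab (hbc.trans hcd))

lemma IsCap.alternating {T : Finset Plane} (h : IsCap T) : Alternating T := by
  intro a ha b hb c hc d hd hab hbc hcd
  have h1 := h.2 a ha b hb c hc hab hbc
  have h2 := h.2 b hb c hc d hd hbc hcd
  have h3 := h.2 a ha c hc d hd (hab.trans hbc) hcd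
  have h4 := h.2 a ha b hb d hd hab (hbc.trans hcd)
  have key : ∀ p q r : Plane, orient r q p = -orient p q r := by
    intro p q r; unfold orient; ring
  rw [Set.inter_comm, segment_symm, segment_symm ℝ a c]
  exact segment_inter_nonempty (by rw [key]; linarith) (by rw [key]; linarith)
    (by rw [key]; linarith) (by rw [key]; linarith)

/-- Each pair lies on one side of the line through the other, so `u`, `u'`, `l'`, `l` form a convex
quadrilateral with these segments as diagonals. -/
lemma IsDoubleChain.segment_inter_nonempty {U L : Finset Plane} (h : IsDoubleChain U L)
    {u u' l l' : Plane} (hu : u ∈ U) (hu' : u' ∈ U) (hl : l ∈ L) (hl' : l' ∈ L)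
    (huu : u.1 < u'.1) (hll : l.1 < l'.1) : (segment ℝ u l' ∩ segment ℝ u' l).Nonempty := by
  have h1 := h.lower_below u hu u' hu' huu l hl
  have h2 := h.lower_below u hu u' hu' huu l' hl'
  have h3 := h.upper_above l hl l' hl' hll u hu
  have h4 := h.upper_above l hl l' hl' hll u' hu'
  rw [Set.inter_comm, segment_symm, segment_symm ℝ u l']
  refine DoubleChain.segment_inter_nonempty h4 ?_ ?_ h3
  · rw [← orient_rotate, orient_swap]; linarith
  · rw [← orient_rotate, orient_swap]; linarith

end Geometry

/-! ### From a polygonization to a path system on a chain -/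

section Graphs

open SimpleGraph

variable {S : Finset Plane} {G G' : SimpleGraph S}

lemma NonCrossing.not_nonempty (h : NonCrossing G) {a b c d : S} (hab : G.Adj a b)
    (hcd : G.Adj c d) (hac : a ≠ c) (had : a ≠ d) (hbc : b ≠ c) (hbd : b ≠ d) :
    ¬ (segment ℝ (a : Plane) b ∩ segment ℝ (c : Plane) d).Nonempty := by
  rintro ⟨x, hx⟩
  have hne : s(a, b) ≠ s(c, d) := by
    intro h
    rcases Sym2.eq_iff.1 h with ⟨h, -⟩ | ⟨h, -⟩
    · exact hac h
    · exact had h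
  obtain ⟨h1, h2⟩ := h a b c d hab hcd hne hx
  simp only [Set.mem_insert_iff, Set.mem_singleton_iff] at h1 h2
  rcases h1 with rfl | rfl <;> rcases h2 with h2 | h2
  · exact hac (Subtype.ext h2)
  · exact had (Subtype.ext h2)
  · exact hbc (Subtype.ext h2)
  · exact hbd (Subtype.ext h2)

lemma mem_edges_iff_link {V : Type*} {H : SimpleGraph V} {x y : V} : ∀ {a b : V} (p : H.Walk a b),
    s(x, y) ∈ p.edges ↔ Link p.support x y
  | _, _, .nil => by simp [not_link_singleton]
  | _, _, .cons h .nil => by simp [link_cons_cons, not_link_singleton]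
  | _, _, .cons h (.cons h' p) => by
    have := mem_edges_iff_link (x := x) (y := y) (.cons h' p)
    rw [Walk.edges_cons, List.mem_cons, this]
    simp only [Walk.support_cons, link_cons_cons, Sym2.eq_iff, or_assoc]

lemma link_cons_iff_of_ne {α : Type*} {a x y : α} {l : List α} (hx : x ≠ a) (hy : y ≠ a) :
    Link (a :: l) x y ↔ Link l x y := by
  cases l with
  | nil => exact Iff.rfl
  | cons b l => simp [link_cons_cons, hx, hy]

lemma IsPolygonization.ncard_neighborSet (h : IsPolygonization G) (v : S) :
    (G.neighborSet v).ncard = 2 := by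
  classical
  obtain ⟨-, a, p, hp, hG⟩ := h
  rw [← hp.isCycle.ncard_neighborSet_toSubgraph_eq_two (hp.mem_support v)]
  congr 1
  ext w
  simp only [mem_neighborSet, Subgraph.mem_neighborSet, Walk.adj_toSubgraph_iff_mem_edges]
  exact ⟨fun h => hG _ h, fun h => p.adj_of_mem_edges h⟩

/-- The edges of `G` within `T`, as a relation between first coordinates. -/
def edgesWithin (G : SimpleGraph S) (T : Finset Plane) (x y : ℝ) : Prop :=
  ∃ p q : S, (p : Plane) ∈ T ∧ (q : Plane) ∈ T ∧ G.Adj p q ∧ (p : Plane).1 = x ∧ (q : Plane).1 = y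

/-- Started at `c` outside `T`, the cycle opens into a list whose maximal runs inside `T` are the
paths. Without such a vertex the whole cycle could lie in `T`. -/
lemma IsPolygonization.isPathForest (h : IsPolygonization G) {T : Finset Plane} (hTS : T ⊆ S)
    (hinj : Set.InjOn Prod.fst (T : Set Plane)) (hT : Alternating T) {c : S}
    (hc : (c : Plane) ∉ T) : IsPathForest (T.image Prod.fst) (edgesWithin G T) := by
  classical
  obtain ⟨hnc, a, p₀, hp₀, hG⟩ := h
  obtain ⟨p, hp, hpG⟩ : ∃ p : G.Walk c c, p.IsHamiltonianCycle ∧ ∀ x y, G.Adj x y ↔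
      s(x, y) ∈ p.edges := by
    refine ⟨p₀.rotate c (hp₀.mem_support c), (Walk.isHamiltonianCycle_rotate _).2 hp₀,
      fun x y => ?_⟩
    rw [(p₀.rotate_edges c _).mem_iff]
    exact ⟨fun h => hG _ h, fun h => p₀.adj_of_mem_edges h⟩
  -- The support has `c` at both ends; its tail lists every vertex exactly once.
  have hmem : ∀ x, x ∈ p.support.tail := fun x => by
    have := hp.mem_support x
    rw [← Walk.cons_tail_support, List.mem_cons] at this
    rcases this with rfl | hx
    · exact Walk.end_mem_tail_support hp.isCycle.not_nil
    · exact hx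
  obtain ⟨r, R, h₁, -, h₃⟩ := exists_runs (fun x : S => (x : Plane) ∈ T) p.support.tail
  have hadj : ∀ x y : S, (∃ l ∈ r :: R, Link l x y) ↔
      (x : Plane) ∈ T ∧ (y : Plane) ∈ T ∧ G.Adj x y := by
    intro x y
    rw [h₃, hpG, mem_edges_iff_link]
    constructor
    · rintro ⟨h, hx, hy⟩
      refine ⟨hx, hy, ?_⟩
      rw [← Walk.cons_tail_support]
      exact h.cons
    · rintro ⟨hx, hy, h⟩
      rw [← Walk.cons_tail_support, link_cons_iff_of_ne] at h
      · exact ⟨h, hx, hy⟩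
      · rintro rfl; exact hc hx
      · rintro rfl; exact hc hy
  have hfl : ((r :: R).map (List.map fun x : S => (x : Plane).1)).flatten =
      (p.support.tail.filter fun x : S => decide ((x : Plane) ∈ T)).map
        fun x : S => (x : Plane).1 := by
    rw [← h₁, List.map_flatten]
  refine isPathForest_of_lists (R := (r :: R).map (List.map fun x : S => (x : Plane).1)) ?_
    ?_ ?_ ?_
  · rw [hfl]
    refine List.Nodup.map_on ?_ (hp.isCycle.support_nodup.filter _)
    intro x hx y hy hxy
    simp only [List.mem_filter, decide_eq_true_eq] at hx hy
    exact Subtype.ext (hinj hx.2 hy.2 hxy)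
  · intro i
    rw [hfl]
    simp only [List.mem_map, List.mem_filter, decide_eq_true_eq, Finset.mem_image]
    constructor
    · rintro ⟨x, hx, rfl⟩
      exact ⟨x, hx.2, rfl⟩
    · rintro ⟨x, hx, rfl⟩
      exact ⟨⟨x, hTS hx⟩, ⟨hmem _, hx⟩, rfl⟩
  · intro x y
    simp only [List.mem_map, exists_exists_and_eq_and, link_map]
    constructor
    · rintro ⟨u, v, hu, hv, huv, rfl, rfl⟩
      obtain ⟨l, hl, h⟩ := (hadj u v).2 ⟨hu, hv, huv⟩
      exact ⟨l, hl, u, v, h, rfl, rfl⟩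
    · rintro ⟨l, hl, u, v, h, rfl, rfl⟩
      obtain ⟨hu, hv, huv⟩ := (hadj u v).1 ⟨l, hl, h⟩
      exact ⟨u, v, hu, hv, huv, rfl, rfl⟩
  · rintro _ _ _ _ hab hbc hcd ⟨a, c, ha, hc, hac, rfl, rfl⟩ ⟨b, d, hb, hd, hbd, rfl, rfl⟩
    have hne : ∀ {x y : S}, (x : Plane).1 < (y : Plane).1 → x ≠ y := by
      rintro x _ h rfl
      exact h.false
    exact hnc.not_nonempty hac hbd (hne hab) (hne (hab.trans (hbc.trans hcd))) (hne hbc).symm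
      (hne hcd) (hT a ha b hb c hc d hd hab hbc hcd)

lemma adj_iff_of_edgesWithin_eq {T : Finset Plane} (hinj : Set.InjOn Prod.fst (T : Set Plane))
    (h : edgesWithin G T = edgesWithin G' T) {p q : S} (hp : (p : Plane) ∈ T)
    (hq : (q : Plane) ∈ T) : G.Adj p q ↔ G'.Adj p q := by
  have key : ∀ H : SimpleGraph S, edgesWithin H T (p : Plane).1 (q : Plane).1 ↔ H.Adj p q := by
    intro H
    constructor
    · rintro ⟨p', q', hp', hq', hadj, h1, h2⟩
      rwa [← Subtype.ext (hinj hp' hp h1), ← Subtype.ext (hinj hq' hq h2)]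
    · exact fun hadj => ⟨p, q, hp, hq, hadj, rfl, rfl⟩
  rw [← key G, ← key G', h]

/-! ### Edges between the chains are forced -/

/-- Two edges between `U` and `L` whose endpoints are in opposite order meet. -/
def Facing (U L : Finset Plane) : Prop :=
  ∀ u ∈ U, ∀ u' ∈ U, ∀ l ∈ L, ∀ l' ∈ L, u.1 < u'.1 → l.1 < l'.1 →
    (segment ℝ u l' ∩ segment ℝ u' l).Nonempty

/-- Both graphs have degree two at `v`, so an edge missing from `G'` is made up for by one missing
from `G`. -/
lemma exists_adj_not_adj (hG : IsPolygonization G) (hG' : IsPolygonization G') {v w : S}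
    (h : G.Adj v w) (h' : ¬ G'.Adj v w) : ∃ x, G'.Adj v x ∧ ¬ G.Adj v x := by
  by_contra! hcon
  have hss : G'.neighborSet v ⊂ G.neighborSet v :=
    (Set.ssubset_iff_of_subset fun x hx => hcon x hx).2 ⟨w, h, h'⟩
  have := Set.ncard_lt_ncard hss (Set.toFinite _)
  rw [hG.ncard_neighborSet, hG'.ncard_neighborSet] at this
  exact this.false

/-- At the first cross edge that belongs to one of two polygonizations only, the other one
has a crossing. -/
lemma false_of_first_difference {U L : Finset Plane} (hS : S = U ∪ L) (hd : Disjoint U L)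
    (hU : Set.InjOn Prod.fst (U : Set Plane)) (hL : Set.InjOn Prod.fst (L : Set Plane))
    (hUL : Facing U L) (hG : IsPolygonization G) (hG' : IsPolygonization G')
    (hGU : edgesWithin G U = edgesWithin G' U) (hGL : edgesWithin G L = edgesWithin G' L)
    {u l : S} (hu : (u : Plane) ∈ U) (hl : (l : Plane) ∈ L) (h : G.Adj u l) (h' : ¬ G'.Adj u l)
    (hminl : ∀ k : S, (k : Plane) ∈ L → (k : Plane).1 < (l : Plane).1 →
      (G.Adj u k ↔ G'.Adj u k))
    (hminu : ∀ v k : S, (v : Plane) ∈ U → (k : Plane) ∈ L → (v : Plane).1 < (u : Plane).1 →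
      (G.Adj v k ↔ G'.Adj v k)) : False := by
  have hmem : ∀ x : S, (x : Plane) ∈ U ∨ (x : Plane) ∈ L := fun x =>
    Finset.mem_union.1 (hS.le x.2)
  -- In `G'`, both `u` and `l` have a replacement for the edge `u l`. As the edges within the chains
  -- agree, the new neighbours `k` of `u` and `v` of `l` lie on the opposite chains; by minimality
  -- `k` is right of `l` and `v` right of `u`, so `u k` and `v l` cross.
  obtain ⟨k, hk', hk⟩ := exists_adj_not_adj hG hG' h h'
  obtain ⟨v, hv', hv⟩ := exists_adj_not_adj hG hG' h.symm fun e => h' e.symm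
  have hkL : (k : Plane) ∈ L := (hmem k).resolve_left fun hkU =>
    hk ((adj_iff_of_edgesWithin_eq hU hGU hu hkU).2 hk')
  have hvU : (v : Plane) ∈ U := (hmem v).resolve_right fun hvL =>
    hv ((adj_iff_of_edgesWithin_eq hL hGL hl hvL).2 hv')
  have hkl : k ≠ l := by rintro rfl; exact h' hk'
  have hvu : v ≠ u := by rintro rfl; exact h' hv'.symm
  have hlk : (l : Plane).1 < (k : Plane).1 := by
    refine lt_of_le_of_ne (not_lt.1 fun hlt => hk ((hminl k hkL hlt).2 hk')) fun e => ?_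
    exact hkl (Subtype.ext (hL hkL hl e.symm))
  have huv : (u : Plane).1 < (v : Plane).1 := by
    refine lt_of_le_of_ne (not_lt.1 fun hlt => ?_) fun e => ?_
    · exact hv ((hminu v l hvU hl hlt).2 hv'.symm).symm
    · exact hvu (Subtype.ext (hU hvU hu e.symm))
  have hne : ∀ {x y : S}, (x : Plane) ∈ U → (y : Plane) ∈ L → x ≠ y := by
    rintro x _ hx hy rfl
    exact Finset.disjoint_left.1 hd hx hy
  exact hG'.1.not_nonempty hk' hv'.symm hvu.symm (hne hu hl) (hne hvU hkL).symm hkl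
    (hUL u hu v hvU l hl k hkL huv hlk)

/-- A polygonization is determined by its edges within `U` and within `L`. -/
lemma eq_of_edgesWithin_eq {U L : Finset Plane} (hS : S = U ∪ L) (hd : Disjoint U L)
    (hU : Set.InjOn Prod.fst (U : Set Plane)) (hL : Set.InjOn Prod.fst (L : Set Plane))
    (hUL : Facing U L) (hG : IsPolygonization G) (hG' : IsPolygonization G')
    (hGU : edgesWithin G U = edgesWithin G' U) (hGL : edgesWithin G L = edgesWithin G' L) :
    G = G' := by
  classical
  have hcross : ∀ u l : S, (u : Plane) ∈ U → (l : Plane) ∈ L → (G.Adj u l ↔ G'.Adj u l) := by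
    by_contra! hcon
    have hne : (Finset.univ.filter fun u : S => (u : Plane) ∈ U ∧ ∃ l : S, (l : Plane) ∈ L ∧
        ¬ (G.Adj u l ↔ G'.Adj u l)).Nonempty := by
      obtain ⟨u, l, hu, hl, h⟩ := hcon
      exact ⟨u, Finset.mem_filter.2 ⟨Finset.mem_univ _, hu, l, hl, by tauto⟩⟩
    obtain ⟨u, hu, humin⟩ := Finset.exists_min_image _ (fun u : S => (u : Plane).1) hne
    simp only [Finset.mem_filter, Finset.mem_univ, true_and] at hu humin
    obtain ⟨hu, l₀, hl₀, h₀⟩ := hu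
    have hne' : (Finset.univ.filter fun l : S => (l : Plane) ∈ L ∧
        ¬ (G.Adj u l ↔ G'.Adj u l)).Nonempty :=
      ⟨l₀, Finset.mem_filter.2 ⟨Finset.mem_univ _, hl₀, h₀⟩⟩
    obtain ⟨l, hl, hlmin⟩ := Finset.exists_min_image _ (fun l : S => (l : Plane).1) hne'
    simp only [Finset.mem_filter, Finset.mem_univ, true_and] at hl hlmin
    obtain ⟨hl, h⟩ := hl
    have hminl : ∀ k : S, (k : Plane) ∈ L → (k : Plane).1 < (l : Plane).1 →
        (G.Adj u k ↔ G'.Adj u k) := by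
      intro k hk hkl
      by_contra hne
      exact (hlmin k ⟨hk, hne⟩).not_gt hkl
    have hminu : ∀ v k : S, (v : Plane) ∈ U → (k : Plane) ∈ L →
        (v : Plane).1 < (u : Plane).1 → (G.Adj v k ↔ G'.Adj v k) := by
      intro v k hv hk hvu
      by_contra hne
      exact (humin v ⟨hv, k, hk, hne⟩).not_gt hvu
    by_cases hGul : G.Adj u l
    · exact false_of_first_difference hS hd hU hL hUL hG hG' hGU hGL hu hl hGul
        (fun e => h ⟨fun _ => e, fun _ => hGul⟩) hminl hminu
    · have hGul' : G'.Adj u l := by tauto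
      exact false_of_first_difference hS hd hU hL hUL hG' hG hGU.symm hGL.symm hu hl hGul'
        hGul (fun k hk hkl => (hminl k hk hkl).symm) fun v k hv hk hvu => (hminu v k hv hk hvu).symm
  ext p q
  have hmem : ∀ x : S, (x : Plane) ∈ U ∨ (x : Plane) ∈ L := fun x =>
    Finset.mem_union.1 (hS.le x.2)
  rcases hmem p with hp | hp <;> rcases hmem q with hq | hq
  · exact adj_iff_of_edgesWithin_eq hU hGU hp hq
  · exact hcross p q hp hq
  · rw [G.adj_comm, G'.adj_comm, hcross q p hq hp]
  · exact adj_iff_of_edgesWithin_eq hL hGL hp hq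

end Graphs

/-! ### The bound for two chains and for one -/

section Bound

lemma numPolygonizations_le_of_facing {U L : Finset Plane} (hd : Disjoint U L)
    (hU : Set.InjOn Prod.fst (U : Set Plane)) (hL : Set.InjOn Prod.fst (L : Set Plane))
    (hUL : Facing U L) (aU : Alternating U) (aL : Alternating L) (hneU : U.Nonempty)
    (hneL : L.Nonempty) :
    (numPolygonizations (U ∪ L) : ℝ) ≤ 5.610718614 ^ (U.card + L.card) := by
  classical
  obtain ⟨cU, hcU, injU⟩ := exists_code (U.image Prod.fst)
  obtain ⟨cL, hcL, injL⟩ := exists_code (L.image Prod.fst)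
  obtain ⟨u, hu⟩ := hneU
  obtain ⟨l, hl⟩ := hneL
  have fU : ∀ G : SimpleGraph ↥(U ∪ L), IsPolygonization G →
      IsPathForest (U.image Prod.fst) (edgesWithin G U) := fun G hG =>
    hG.isPathForest Finset.subset_union_left hU aU
      (c := ⟨l, Finset.mem_union_right _ hl⟩) fun h => Finset.disjoint_left.1 hd h hl
  have fL : ∀ G : SimpleGraph ↥(U ∪ L), IsPolygonization G →
      IsPathForest (L.image Prod.fst) (edgesWithin G L) := fun G hG =>
    hG.isPathForest Finset.subset_union_right hL aL
      (c := ⟨u, Finset.mem_union_left _ hu⟩) fun h => Finset.disjoint_left.1 hd hu h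
  have hle : numPolygonizations (U ∪ L) ≤
      (codeWords (U.image Prod.fst) ×ˢ codeWords (L.image Prod.fst)).card := by
    rw [numPolygonizations, ← Set.ncard_coe_finset]
    refine Set.ncard_le_ncard_of_injOn (fun G => (cU (edgesWithin G U), cL (edgesWithin G L)))
      ?_ ?_ (Finset.finite_toSet _)
    · intro G hG
      rw [Finset.mem_coe, Finset.mem_product]
      exact ⟨hcU _ (fU G hG), hcL _ (fL G hG)⟩
    · intro G hG G' hG' h
      rw [Prod.mk.injEq] at h
      exact eq_of_edgesWithin_eq rfl hd hU hL hUL hG hG' (injU _ _ (fU G hG) (fU G' hG') h.1)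
        (injL _ _ (fL G hG) (fL G' hG') h.2)
  calc (numPolygonizations (U ∪ L) : ℝ)
      ≤ (codeWords (U.image Prod.fst)).card * (codeWords (L.image Prod.fst)).card := by
        rw [Finset.card_product] at hle
        exact_mod_cast hle
    _ ≤ 5.610718614 ^ U.card * 5.610718614 ^ L.card := by
        refine mul_le_mul ?_ ?_ (Nat.cast_nonneg _) (by positivity)
        · rw [← Finset.card_image_of_injOn hU]
          exact card_codeWords_le _
        · rw [← Finset.card_image_of_injOn hL]
          exact card_codeWords_le _
    _ = _ := (pow_add _ _ _).symm

lemma Alternating.mono {T T' : Finset Plane} (h : Alternating T) (hT : T' ⊆ T) : Alternating T' :=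
  fun a ha b hb c hc d hd => h a (hT ha) b (hT hb) c (hT hc) d (hT hd)

/-- This covers the case of an empty chain, where no vertex outside opens the cycle. One point is
split off as a chain of its own, for which `Facing` is vacuous, and the exponent is unchanged. -/
lemma numPolygonizations_le_of_alternating {T : Finset Plane}
    (hT : Set.InjOn Prod.fst (T : Set Plane)) (aT : Alternating T) :
    (numPolygonizations T : ℝ) ≤ 5.610718614 ^ T.card := by
  classical
  rcases le_or_gt T.card 1 with h | h
  · have : Subsingleton T := ⟨fun x y => Subtype.ext (Finset.card_le_one.1 h x x.2 y y.2)⟩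
    have hsub : Subsingleton (SimpleGraph T) := ⟨fun G G' => by
      ext x y
      rw [Subsingleton.elim x y]
      simp⟩
    have h1 : numPolygonizations T ≤ 1 := Set.ncard_le_one_of_subsingleton _
    calc (numPolygonizations T : ℝ) ≤ 1 := by exact_mod_cast h1
      _ ≤ _ := one_le_pow₀ (by norm_num)
  · obtain ⟨a, ha, b, hb, hab⟩ := Finset.one_lt_card.1 h
    have hunion : {a} ∪ T.erase a = T := by
      rw [← Finset.insert_eq, Finset.insert_erase ha]
    have hle := numPolygonizations_le_of_facing (U := {a}) (L := T.erase a) (by simp) (by simp)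
      (hT.mono (by simp)) (by
        intro u hu u' hu' _ _ _ _ hlt
        rw [Finset.mem_singleton.1 hu, Finset.mem_singleton.1 hu'] at hlt
        exact (hlt.false).elim)
      (aT.mono (by simpa using ha)) (aT.mono (Finset.erase_subset _ _))
      (Finset.singleton_nonempty a) ⟨b, Finset.mem_erase.2 ⟨hab.symm, hb⟩⟩
    rwa [hunion, Finset.card_singleton, add_comm, Finset.card_erase_add_one ha] at hle

end Bound

end DoubleChain

theorem mainTheorem4 :
    ∃ C : ℝ, 0 < C ∧ ∀ (n m : ℕ) (U L : Finset DoubleChain.Plane),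
      U.card = n → L.card = m → DoubleChain.IsDoubleChain U L →
        (DoubleChain.numPolygonizations (U ∪ L) : ℝ) ≤ C * (5.610718614 : ℝ) ^ (n + m) := by
  refine ⟨1, one_pos, ?_⟩
  rintro _ _ U L rfl rfl h
  rw [one_mul]
  obtain ⟨⟨hU, aU⟩, hL, aL⟩ : (Set.InjOn Prod.fst (U : Set DoubleChain.Plane) ∧
      DoubleChain.Alternating U) ∧ Set.InjOn Prod.fst (L : Set DoubleChain.Plane) ∧
      DoubleChain.Alternating L := by
    rcases h.opposed with ⟨hU, hL⟩ | ⟨hU, hL⟩ <;>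
      exact ⟨⟨hU.1, hU.alternating⟩, hL.1, hL.alternating⟩
  rcases U.eq_empty_or_nonempty with rfl | hneU
  · simpa using DoubleChain.numPolygonizations_le_of_alternating hL aL
  rcases L.eq_empty_or_nonempty with rfl | hneL
  · simpa using DoubleChain.numPolygonizations_le_of_alternating hU aU
  exact DoubleChain.numPolygonizations_le_of_facing h.disjoint hU hL
    (fun u hu u' hu' l hl l' hl' => h.segment_inter_nonempty hu hu' hl hl') aU aL hneU hneL
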